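/- Let $n\ge 1$ be an integer and let $p,\tilde p\in(1,\infty)$. All functions are complex valued. For an open set $O\subset\mathbb R^n$, let $D_k$ and $\Delta=\sum_{k=1}^n D_kD_k$ denote the weak (distributional) partial derivatives and the distributional Laplacian on $O$. Let $W^{\Delta,p}(O)$ be the space of all $u\in L^p(O)$ with $\Delta u\in L^p(O)$, and let $W^{2,p}(O)$ be the space of all $f\in L^p(O)$ whose weak derivatives $D^\alpha f$, $|\alpha|\le 2$, belong to $L^p(O)$. Let $G_n$ be the Bessel potential $$G_n(x)=\int_0^\infty e^{-\frac{|x|^2}{4t}-t}\,(4\pi t)^{-n/2}\,dt,\qquad x\in\mathbb R^n .$$ **Theorem.** Let $u\in W^{\Delta,p}(\mathbb R^n\setminus\{0\})\cap W^{\Delta,\tilde p}(\mathbb R^n\setminus\{0\})$, and suppose that $$u=c_0G_n+\sum_{k=1}^n c_kD_kG_n+v,\qquad u=\tilde c_0G_n+\sum_{k=1}^n\tilde c_kD_kG_n+\tilde v \qquad\text{on } \mathbb R^n\setminus\{0\}$$ (in the sense of distributions on $\mathbb R^n\setminus\{0\}$), where $c_0,\dots,c_n,\tilde c_0,\dots,\tilde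 c_n\in\mathbb C$, $v\in W^{2,p}(\mathbb R^n)$ and $\tilde v\in W^{2,\tilde p}(\mathbb R^n)$. Then $c_0=\tilde c_0$, $c_k=\tilde c_k$ for every $k=1,\dots,n$, and $v=\tilde v$ almost everywhere on $\mathbb R^n$. -/

import Mathlib

open MeasureTheory TopologicalSpace
open scoped ENNReal Distributions LineDeriv

namespace PuncturedSobolev

/-- The open set `ℝⁿ ∖ {0}`. -/
def punctured (n : ℕ) : Opens (EuclideanSpace ℝ (Fin n)) :=
  ⟨{0}ᶜ, isOpen_compl_singleton⟩

/-- The `k`-th vector of the standard basis of `ℝⁿ`. -/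
noncomputable def stdVec {n : ℕ} (k : Fin n) : EuclideanSpace ℝ (Fin n) :=
  EuclideanSpace.single k (1 : ℝ)

/-- The restriction of a function `f` to the open set `O`, regarded as the complex valued
distribution `φ ↦ ∫ φ f` on `O`.  All functions to which this is applied below are locally
integrable on `O` (for other functions Mathlib's convention gives the zero distribution). -/
noncomputable def regularDist {n : ℕ} (O : Opens (EuclideanSpace ℝ (Fin n)))
    (f : EuclideanSpace ℝ (Fin n) → ℂ) : 𝓓'(O, ℂ) :=
  ContinuousLinearMap.toUniformConvergenceCLM (RingHom.id ℝ) ℂ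
    {S : Set 𝓓(O, ℝ) | IsCompact S}
    (TestFunction.integralAgainstBilinCLM (ContinuousLinearMap.lsmul ℝ ℝ : ℝ →L[ℝ] ℂ →L[ℝ] ℂ)
      volume f)

theorem regularDist_apply {n : ℕ} {O : Opens (EuclideanSpace ℝ (Fin n))}
    {f : EuclideanSpace ℝ (Fin n) → ℂ} (hf : LocallyIntegrableOn f O volume) (φ : 𝓓(O, ℝ)) :
    regularDist O f φ = ∫ x, (φ x : ℂ) * f x := by
  have h : regularDist O f φ = TestFunction.integralAgainstBilinCLM
      (ContinuousLinearMap.lsmul ℝ ℝ : ℝ →L[ℝ] ℂ →L[ℝ] ℂ) volume f φ := rfl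
  rw [h, TestFunction.integralAgainstBilinCLM_eq_integral hf]
  simp

/-- The weak (distributional) partial derivative `D_k` on an open subset of `ℝⁿ`. -/
noncomputable def weakPartial {n : ℕ} {O : Opens (EuclideanSpace ℝ (Fin n))} (k : Fin n)
    (T : 𝓓'(O, ℂ)) : 𝓓'(O, ℂ) :=
  ∂_{stdVec k} T

/-- The distributional Laplacian `Δ = ∑ D_k D_k` on an open subset of `ℝⁿ`. -/
noncomputable def weakLaplacian {n : ℕ} {O : Opens (EuclideanSpace ℝ (Fin n))}
    (T : 𝓓'(O, ℂ)) : 𝓓'(O, ℂ) :=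
  ∑ k : Fin n, weakPartial k (weakPartial k T)

/-- "The distribution `T` on `O` belongs to `L^p(O)`". -/
def DistMemLp {n : ℕ} {O : Opens (EuclideanSpace ℝ (Fin n))} (p : ℝ≥0∞) (T : 𝓓'(O, ℂ)) : Prop :=
  ∃ g : EuclideanSpace ℝ (Fin n) → ℂ,
    MemLp g p (volume.restrict (O : Set (EuclideanSpace ℝ (Fin n)))) ∧ T = regularDist O g

/-- The space `W^{Δ,p}(O)`: `u ∈ L^p(O)` whose distributional Laplacian on `O` is in `L^p(O)`. -/
def MemWLaplacian {n : ℕ} (O : Opens (EuclideanSpace ℝ (Fin n))) (p : ℝ≥0∞)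
    (u : EuclideanSpace ℝ (Fin n) → ℂ) : Prop :=
  MemLp u p (volume.restrict (O : Set (EuclideanSpace ℝ (Fin n)))) ∧
    DistMemLp p (weakLaplacian (regularDist O u))

/-- The Sobolev space `W^{m,p}(O)`: `f ∈ L^p(O)` all of whose weak derivatives
`D_{i_1} ⋯ D_{i_j}` of order `j ≤ m` on `O` belong to `L^p(O)`. -/
def MemW {n : ℕ} (O : Opens (EuclideanSpace ℝ (Fin n))) (m : ℕ) (p : ℝ≥0∞)
    (f : EuclideanSpace ℝ (Fin n) → ℂ) : Prop :=
  MemLp f p (volume.restrict (O : Set (EuclideanSpace ℝ (Fin n)))) ∧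
    ∀ j : ℕ, j ≤ m → ∀ i : Fin j → Fin n,
      DistMemLp p (∂^{fun l => stdVec (i l)} (regularDist O f))

/-- The Bessel potential
`G_n(x) = ∫_0^∞ exp(-|x|²/(4t) - t) (4πt)^{-n/2} dt`, with values in `[0,∞]`. -/
noncomputable def besselG (n : ℕ) (x : EuclideanSpace ℝ (Fin n)) : ℝ≥0∞ :=
  ∫⁻ t in Set.Ioi (0 : ℝ),
    ENNReal.ofReal (Real.exp (-‖x‖ ^ 2 / (4 * t) - t) * (4 * Real.pi * t) ^ (-(n : ℝ) / 2))

/-- `G_n` as a distribution on `ℝⁿ ∖ {0}`; there `G_n` is finite and smooth. -/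
noncomputable def distG (n : ℕ) : 𝓓'(punctured n, ℂ) :=
  regularDist (punctured n) fun x => (((besselG n x).toReal : ℝ) : ℂ)

/-- The `G_n`-representation `u = c₀ G_n + ∑ c_k D_k G_n + v`, an identity between distributions
on `ℝⁿ ∖ {0}`. -/
def IsGRepresentation {n : ℕ} (u : EuclideanSpace ℝ (Fin n) → ℂ) (c₀ : ℂ) (c : Fin n → ℂ)
    (v : EuclideanSpace ℝ (Fin n) → ℂ) : Prop :=
  regularDist (punctured n) u =
    c₀ • distG n + ∑ k : Fin n, c k • weakPartial k (distG n) + regularDist (punctured n) v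

end PuncturedSobolev

/-! Subtracting the two representations gives `v' - v = a G_n + ∑ b_k D_k G_n` almost everywhere,
where `a` and `b` are the differences of the coefficients: the identity holds off the origin, which
is a null set. Now apply `1 - Δ` on all of `ℝⁿ`. The left side becomes a locally integrable
function, because `v` and `v'` have locally integrable weak Laplacians. The right side becomes `a δ
+ ∑ b_k D_k δ`, supported at the origin. A locally integrable function that vanishes as a
distribution off the origin is zero, so this point distribution is zero and all its coefficients
vanish; then `v = v'`. The exponents enter only through local integrability, so they may differ. The
analytic input is `integral_sub_laplacian_mul_besselG` and
`integral_sub_laplacian_mul_besselGDeriv`; the argument itself is `coefficients_eq_zero_of_ae_eq`.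
-/

namespace PuncturedSobolev

open scoped SchwartzMap FourierTransform Laplacian
open Set

/-! ### Heat kernel and integrability of `G_n` -/

/-- The damped heat kernel, whose time integral is the Bessel potential. -/
noncomputable def dampedHeatKernel (n : ℕ) (t : ℝ) (x : EuclideanSpace ℝ (Fin n)) : ℝ :=
  Real.exp (-‖x‖ ^ 2 / (4 * t) - t) * (4 * Real.pi * t) ^ (-(n : ℝ) / 2)

theorem dampedHeatKernel_eq (n : ℕ) (t : ℝ) (x : EuclideanSpace ℝ (Fin n)) :
    dampedHeatKernel n t x =
      Real.exp (-t) * (4 * Real.pi * t) ^ (-(n : ℝ) / 2) * Real.exp (-(1 / (4 * t)) * ‖x‖ ^ 2) := by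
  rw [dampedHeatKernel, sub_eq_add_neg, Real.exp_add]
  ring_nf

theorem dampedHeatKernel_nonneg (n : ℕ) {t : ℝ} (ht : 0 < t) (x : EuclideanSpace ℝ (Fin n)) :
    0 ≤ dampedHeatKernel n t x := by
  rw [dampedHeatKernel]; positivity

theorem measurable_dampedHeatKernel (n : ℕ) :
    Measurable fun q : ℝ × EuclideanSpace ℝ (Fin n) => dampedHeatKernel n q.1 q.2 := by
  unfold dampedHeatKernel
  fun_prop

theorem integrable_exp_neg_mul_sq_norm (n : ℕ) {b : ℝ} (hb : 0 < b) :
    Integrable fun x : EuclideanSpace ℝ (Fin n) => Real.exp (-b * ‖x‖ ^ 2) := by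
  have h := (GaussianFourier.integrable_cexp_neg_mul_sq_norm_add
    (V := EuclideanSpace ℝ (Fin n)) (b := (b : ℂ)) (by simpa using hb) 0 0).norm
  refine h.congr (.of_forall fun x => ?_)
  simp [Complex.norm_exp, ← Complex.ofReal_pow]

theorem integrable_dampedHeatKernel (n : ℕ) {t : ℝ} (ht : 0 < t) :
    Integrable (dampedHeatKernel n t) := by
  simp_rw [funext (dampedHeatKernel_eq n t)]
  exact (integrable_exp_neg_mul_sq_norm n (by positivity)).const_mul _

theorem integral_dampedHeatKernel (n : ℕ) {t : ℝ} (ht : 0 < t) :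
    ∫ x, dampedHeatKernel n t x = Real.exp (-t) := by
  simp_rw [dampedHeatKernel_eq]
  rw [integral_const_mul, GaussianFourier.integral_rexp_neg_mul_sq_norm (by positivity),
    finrank_euclideanSpace_fin, mul_assoc, neg_div, Real.rpow_neg (by positivity)]
  have h : Real.pi / (1 / (4 * t)) = 4 * Real.pi * t := by field_simp
  rw [h, inv_mul_cancel₀ (by positivity), mul_one]

/-- Each time slice has mass `e^{-t}`, which is integrable on `(0, ∞)`. This yields `G_n ∈ L¹` and
justifies Fubini. -/
theorem integrable_dampedHeatKernel_prod (n : ℕ) :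
    Integrable (fun q : ℝ × EuclideanSpace ℝ (Fin n) => dampedHeatKernel n q.1 q.2)
      ((volume.restrict (Ioi 0)).prod volume) := by
  rw [integrable_prod_iff (measurable_dampedHeatKernel n).aestronglyMeasurable]
  constructor
  · filter_upwards [ae_restrict_mem measurableSet_Ioi] with t ht
    exact integrable_dampedHeatKernel n ht
  · refine (integrableOn_exp_neg_Ioi 0).congr ?_
    filter_upwards [ae_restrict_mem measurableSet_Ioi] with t ht
    rw [← integral_dampedHeatKernel n ht]
    refine integral_congr_ae (.of_forall fun x => ?_)
    simp [abs_of_nonneg (dampedHeatKernel_nonneg n ht x)]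

theorem toReal_besselG (n : ℕ) (x : EuclideanSpace ℝ (Fin n)) :
    (besselG n x).toReal = ∫ t in Ioi (0 : ℝ), dampedHeatKernel n t x := by
  rw [integral_eq_lintegral_of_nonneg_ae]
  · rfl
  · filter_upwards [ae_restrict_mem measurableSet_Ioi] with t ht
    exact dampedHeatKernel_nonneg n ht x
  · exact ((measurable_dampedHeatKernel n).comp measurable_prodMk_right).aestronglyMeasurable

/-- Integration of a kernel over time, tested against a bounded continuous function. -/
theorem integral_mul_integral_kernel {n : ℕ} {K : ℝ × EuclideanSpace ℝ (Fin n) → ℝ}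
    (hK : Integrable K ((volume.restrict (Ioi 0)).prod volume))
    (f : 𝓢(EuclideanSpace ℝ (Fin n), ℂ)) :
    ∫ x, f x * ((∫ t in Ioi (0 : ℝ), K (t, x) : ℝ) : ℂ) =
      ∫ t in Ioi (0 : ℝ), ∫ x, (K (t, x) : ℂ) * f x := by
  have h : Integrable (fun q : ℝ × EuclideanSpace ℝ (Fin n) => (K q : ℂ) * f q.2)
      ((volume.restrict (Ioi 0)).prod volume) := by
    refine hK.ofReal.mul_bdd (c := SchwartzMap.seminorm ℝ 0 0 f) ?_
      (.of_forall fun q => f.norm_le_seminorm ℝ _)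
    exact (f.continuous.comp continuous_snd).aestronglyMeasurable
  rw [integral_integral_swap h]
  refine integral_congr_ae (.of_forall fun x => ?_)
  simp only
  rw [integral_mul_const, integral_complex_ofReal, mul_comm]

theorem integrable_besselG (n : ℕ) :
    Integrable fun x : EuclideanSpace ℝ (Fin n) => (((besselG n x).toReal : ℝ) : ℂ) := by
  simp_rw [toReal_besselG]
  exact (integrable_dampedHeatKernel_prod n).integral_prod_right.ofReal

/-! ### `(1 - Δ) G_n = δ` by Fourier transform -/

/-- Move the Fourier transform from `g` to the Gaussian, whose transform is explicit; the
normalising power of `4πt` cancels. -/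
theorem integral_dampedHeatKernel_mul_fourier (n : ℕ) {t : ℝ} (ht : 0 < t)
    (g : 𝓢(EuclideanSpace ℝ (Fin n), ℂ)) :
    ∫ x, (dampedHeatKernel n t x : ℂ) * 𝓕 g x =
      ∫ ξ, (Real.exp (-((1 + (2 * Real.pi) ^ 2 * ‖ξ‖ ^ 2)) * t) : ℂ) * g ξ := by
  have hb : 0 < ((1 / (4 * t) : ℝ) : ℂ).re := by rw [Complex.ofReal_re]; positivity
  have J : Integrable fun v : EuclideanSpace ℝ (Fin n) =>
      Complex.exp (-((1 / (4 * t) : ℝ) : ℂ) * ‖v‖ ^ 2) := by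
    simpa using GaussianFourier.integrable_cexp_neg_mul_sq_norm_add (V := EuclideanSpace ℝ (Fin n))
      hb 0 0
  have key : ∫ w, 𝓕 (fun v : EuclideanSpace ℝ (Fin n) =>
      Complex.exp (-((1 / (4 * t) : ℝ) : ℂ) * ‖v‖ ^ 2)) w • g w =
      ∫ x, Complex.exp (-((1 / (4 * t) : ℝ) : ℂ) * ‖x‖ ^ 2) • 𝓕 g x := by
    simpa using! (VectorFourier.integral_fourierIntegral_smul_eq_flip
      (L := innerₗ (EuclideanSpace ℝ (Fin n)))
      Real.continuous_fourierChar continuous_inner J g.integrable)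
  have h1 : ∀ x : EuclideanSpace ℝ (Fin n), (dampedHeatKernel n t x : ℂ) * 𝓕 g x =
      ((Real.exp (-t) * (4 * Real.pi * t) ^ (-(n : ℝ) / 2) : ℝ) : ℂ) *
        (Complex.exp (-((1 / (4 * t) : ℝ) : ℂ) * ‖x‖ ^ 2) • 𝓕 g x) := fun x => by
    rw [dampedHeatKernel_eq, smul_eq_mul, ← mul_assoc]
    push_cast
    rfl
  simp_rw [h1]
  rw [integral_const_mul, ← key, ← integral_const_mul]
  refine integral_congr_ae (.of_forall fun w => ?_)
  simp only [smul_eq_mul]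
  rw [fourier_gaussian_innerProductSpace hb, finrank_euclideanSpace_fin, ← mul_assoc]
  congr 1
  have h2 : ((Real.pi : ℂ) / ((1 / (4 * t) : ℝ) : ℂ)) ^ ((n : ℂ) / 2) =
      (((4 * Real.pi * t) ^ ((n : ℝ) / 2) : ℝ) : ℂ) := by
    rw [Complex.ofReal_cpow (by positivity)]
    congr 1
    · push_cast; field_simp
    · push_cast; rfl
  have h3 : Complex.exp (-(Real.pi : ℂ) ^ 2 * ‖w‖ ^ 2 / ((1 / (4 * t) : ℝ) : ℂ)) =
      ((Real.exp (-((2 * Real.pi) ^ 2 * ‖w‖ ^ 2 * t)) : ℝ) : ℂ) := by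
    push_cast
    congr 1
    field_simp
    ring
  rw [h2, h3, ← Complex.ofReal_mul, ← Complex.ofReal_mul, neg_div, Real.rpow_neg (by positivity)]
  rw [← mul_assoc, mul_assoc (Real.exp _), inv_mul_cancel₀ (by positivity), mul_one,
    ← Real.exp_add]
  ring_nf

theorem fourierInv_sub_laplacian {n : ℕ} (f : 𝓢(EuclideanSpace ℝ (Fin n), ℂ))
    (ξ : EuclideanSpace ℝ (Fin n)) :
    𝓕⁻ (f - Δ f) ξ = ((1 + (2 * Real.pi) ^ 2 * ‖ξ‖ ^ 2 : ℝ) : ℂ) * 𝓕⁻ f ξ := by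
  have h : 𝓕 (Δ f) = -(2 * Real.pi) ^ 2 •
      SchwartzMap.smulLeftCLM ℂ (fun x : EuclideanSpace ℝ (Fin n) => ‖x‖ ^ 2) (𝓕 f) := by
    rw [SchwartzMap.laplacian_eq_fourierMultiplierCLM, FourierTransform.fourier_smul,
      SchwartzMap.fourierMultiplierCLM_apply, FourierTransform.fourier_fourierInv_eq]
  have hs : ∀ g : 𝓢(EuclideanSpace ℝ (Fin n), ℂ), 𝓕⁻ g ξ = 𝓕 g (-ξ) := fun g => by
    rw [SchwartzMap.fourierInv_apply_eq]; rfl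
  have h' : 𝓕 (f - Δ f) = 𝓕 f - 𝓕 (Δ f) := map_sub (FourierTransform.fourierCLM ℂ _) f (Δ f)
  rw [hs, hs, h', h]
  simp only [sub_apply, smul_apply]
  rw [SchwartzMap.smulLeftCLM_apply_apply (by fun_prop)]
  simp
  ring

/-- The Bessel potential is a fundamental solution of `1 - Δ`. -/
theorem integral_sub_laplacian_mul_besselG {n : ℕ} (f : 𝓢(EuclideanSpace ℝ (Fin n), ℂ)) :
    ∫ x, (f - Δ f) x * (((besselG n x).toReal : ℝ) : ℂ) = f 0 := by
  simp_rw [toReal_besselG]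
  rw [integral_mul_integral_kernel (integrable_dampedHeatKernel_prod n)]
  set g := 𝓕⁻ (f - Δ f) with hg
  have hfg : f - Δ f = 𝓕 g := (FourierTransform.fourier_fourierInv_eq _).symm
  have h1 : ∫ t in Ioi (0 : ℝ), ∫ x, (dampedHeatKernel n t x : ℂ) * (f - Δ f) x =
      ∫ t in Ioi (0 : ℝ), ∫ ξ, (Real.exp (-((1 + (2 * Real.pi) ^ 2 * ‖ξ‖ ^ 2)) * t) : ℂ) * g ξ := by
    refine setIntegral_congr_fun measurableSet_Ioi fun t ht => ?_
    rw [hfg]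
    exact integral_dampedHeatKernel_mul_fourier n ht g
  rw [h1, integral_integral_swap]
  -- The time integral is the reciprocal of the symbol of `1 - Δ`, so it cancels the symbol carried
  -- by `g`.
  · have h2 : ∀ ξ, ∫ t in Ioi (0 : ℝ),
        (Real.exp (-((1 + (2 * Real.pi) ^ 2 * ‖ξ‖ ^ 2)) * t) : ℂ) * g ξ = 𝓕⁻ f ξ := fun ξ => by
      have hpos : 0 < 1 + (2 * Real.pi) ^ 2 * ‖ξ‖ ^ 2 := by positivity
      rw [integral_mul_const, integral_complex_ofReal, integral_exp_mul_Ioi (by linarith), hg,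
        fourierInv_sub_laplacian, ← mul_assoc]
      rw [mul_zero, Real.exp_zero, neg_div_neg_eq, ← Complex.ofReal_mul, one_div,
        inv_mul_cancel₀ hpos.ne', Complex.ofReal_one, one_mul]
    simp_rw [h2]
    have h3 : 𝓕 (𝓕⁻ f) 0 = f 0 := by rw [FourierTransform.fourier_fourierInv_eq]
    rw [← h3, SchwartzMap.fourier_coe, Real.fourier_eq]
    simp
  -- Fubini is justified by the majorant `e^{-t} |g(ξ)|`.
  · have h4 : Integrable (fun q : ℝ × EuclideanSpace ℝ (Fin n) => (Real.exp (-q.1) : ℂ) * g q.2)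
        ((volume.restrict (Ioi 0)).prod volume) :=
      (integrableOn_exp_neg_Ioi 0).ofReal.mul_prod g.integrable
    refine h4.mono ?_ ?_
    · refine Continuous.aestronglyMeasurable ?_
      fun_prop
    · have : ∀ᵐ q : ℝ × EuclideanSpace ℝ (Fin n) ∂((volume.restrict (Ioi 0)).prod volume),
          q.1 ∈ Ioi (0 : ℝ) :=
        Measure.quasiMeasurePreserving_fst.ae (ae_restrict_mem measurableSet_Ioi)
      filter_upwards [this] with q hq
      simp only [Function.uncurry, norm_mul, Complex.norm_real, Real.norm_eq_abs, Real.abs_exp]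
      gcongr
      have : 0 ≤ (2 * Real.pi) ^ 2 * ‖q.2‖ ^ 2 * q.1 := by
        have : 0 ≤ q.1 := le_of_lt hq
        positivity
      linarith

/-! ### Derivatives of `G_n` -/

/-- The `k`-th partial derivative of the damped heat kernel. -/
noncomputable def dampedHeatKernelDeriv {n : ℕ} (k : Fin n)
    (q : ℝ × EuclideanSpace ℝ (Fin n)) : ℝ :=
  -(q.2 k / (2 * q.1)) * dampedHeatKernel n q.1 q.2

theorem measurable_dampedHeatKernelDeriv {n : ℕ} (k : Fin n) :
    Measurable (dampedHeatKernelDeriv k) := by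
  unfold dampedHeatKernelDeriv
  exact Measurable.mul (by fun_prop) (measurable_dampedHeatKernel n)

theorem hasLineDerivAt_dampedHeatKernel {n : ℕ} (k : Fin n) (t : ℝ)
    (x : EuclideanSpace ℝ (Fin n)) :
    HasLineDerivAt ℝ (dampedHeatKernel n t) (dampedHeatKernelDeriv k (t, x)) x (stdVec k) := by
  have h1 := (hasStrictFDerivAt_norm_sq x).hasFDerivAt.hasLineDerivAt (stdVec k)
  have h2 : HasDerivAt (fun s : ℝ => ‖x + s • stdVec k‖ ^ 2) (2 * x k) 0 := by
    have h3 : HasDerivAt (fun s : ℝ => ‖x + s • stdVec k‖ ^ 2) _ 0 := h1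
    convert! h3 using 1
    simp [stdVec, EuclideanSpace.inner_single_right]
  have h4 := (((h2.neg.div_const (4 * t)).sub_const t).exp).mul_const
    ((4 * Real.pi * t) ^ (-(n : ℝ) / 2))
  unfold HasLineDerivAt
  convert! h4 using 1
  simp only [dampedHeatKernelDeriv, dampedHeatKernel, zero_smul, add_zero, Pi.neg_apply]
  ring

/-- Half of the Gaussian exponent absorbs the factor `r / t`: use `1 + y ≤ e^y` with `y = r²/(8t)`,
then complete the square in `r/√t`. The power is written `1/2 - 1` to match the Gamma integral at
`1/2`. -/
theorem mul_exp_neg_sq_div_le {r t : ℝ} (ht : 0 < t) :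
    r / (2 * t) * Real.exp (-(1 / (4 * t)) * r ^ 2) ≤
      t ^ ((1 / 2 : ℝ) - 1) * Real.exp (-(1 / (8 * t)) * r ^ 2) := by
  have hst : 0 < √t := Real.sqrt_pos.2 ht
  have h1 : t ^ ((1 / 2 : ℝ) - 1) = 1 / √t := by
    rw [show (1 / 2 : ℝ) - 1 = -(1 / 2) by norm_num, Real.rpow_neg ht.le,
      ← Real.sqrt_eq_rpow, one_div]
  have h2 : Real.exp (-(1 / (8 * t)) * r ^ 2) =
      Real.exp (-(1 / (4 * t)) * r ^ 2) * Real.exp (1 / (8 * t) * r ^ 2) := by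
    rw [← Real.exp_add]
    congr 1
    field_simp
    ring
  rw [h1, h2, mul_left_comm, mul_comm]
  gcongr
  have h3 : 1 / (8 * t) * r ^ 2 + 1 ≤ Real.exp (1 / (8 * t) * r ^ 2) := Real.add_one_le_exp _
  refine le_trans ?_ (mul_le_mul_of_nonneg_left h3 (by positivity))
  have h4 : t = √t * √t := (Real.mul_self_sqrt ht.le).symm
  have h5 : 1 / √t * (1 / (8 * t) * r ^ 2 + 1) - r / (2 * t) =
      ((r / √t - 2) ^ 2 + 4) / (8 * √t) := by
    rw [h4]
    simp only [Real.sqrt_mul_self hst.le]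
    field_simp
    ring
  have h6 : 0 ≤ ((r / √t - 2) ^ 2 + 4) / (8 * √t) := by positivity
  linarith

theorem integrable_dampedHeatKernelDeriv {n : ℕ} (k : Fin n) :
    Integrable (dampedHeatKernelDeriv k) ((volume.restrict (Ioi 0)).prod volume) := by
  let D : ℝ × EuclideanSpace ℝ (Fin n) → ℝ := fun q =>
    (Real.exp (-q.1) * q.1 ^ ((1 / 2 : ℝ) - 1) * (4 * Real.pi * q.1) ^ (-(n : ℝ) / 2)) *
      Real.exp (-(1 / (8 * q.1)) * ‖q.2‖ ^ 2)
  have hDm : Measurable D := by fun_prop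
  have hD : Integrable D ((volume.restrict (Ioi 0)).prod volume) := by
    rw [integrable_prod_iff hDm.aestronglyMeasurable]
    constructor
    · filter_upwards [ae_restrict_mem measurableSet_Ioi] with t ht
      have ht : 0 < t := ht
      exact (integrable_exp_neg_mul_sq_norm n (b := 1 / (8 * t)) (by positivity)).const_mul
        (Real.exp (-t) * t ^ ((1 / 2 : ℝ) - 1) * (4 * Real.pi * t) ^ (-(n : ℝ) / 2))
    -- The widened Gaussian has mass `2^{n/2}` times that of the original, leaving `2^{n/2} e^{-t}
    -- t^{-1/2}`.
    · refine ((Real.GammaIntegral_convergent (s := 1 / 2) (by norm_num)).mul_const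
        ((2 : ℝ) ^ ((n : ℝ) / 2))).congr ?_
      filter_upwards [ae_restrict_mem measurableSet_Ioi] with t ht
      have ht : 0 < t := ht
      have h1 : ∀ x, ‖D (t, x)‖ = D (t, x) := fun x => by
        rw [Real.norm_of_nonneg]
        simp only [D]
        positivity
      simp_rw [h1, D]
      rw [integral_const_mul, GaussianFourier.integral_rexp_neg_mul_sq_norm (by positivity),
        finrank_euclideanSpace_fin, neg_div, Real.rpow_neg (by positivity)]
      have h2 : Real.pi / (1 / (8 * t)) = 2 * (4 * Real.pi * t) := by field_simp; norm_num
      rw [h2, Real.mul_rpow (x := 2) (y := 4 * Real.pi * t) (by positivity) (by positivity)]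
      generalize ha : (4 * Real.pi * t) ^ ((n : ℝ) / 2) = a
      have h3 : a ≠ 0 := by rw [← ha]; positivity
      field_simp
  refine hD.mono' (measurable_dampedHeatKernelDeriv k).aestronglyMeasurable ?_
  have : ∀ᵐ q : ℝ × EuclideanSpace ℝ (Fin n) ∂((volume.restrict (Ioi 0)).prod volume),
      q.1 ∈ Ioi (0 : ℝ) :=
    Measure.quasiMeasurePreserving_fst.ae (ae_restrict_mem measurableSet_Ioi)
  filter_upwards [this] with q hq
  have hq : 0 < q.1 := hq
  have hk : |q.2 k| ≤ ‖q.2‖ := PiLp.norm_apply_le q.2 k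
  have key := mul_exp_neg_sq_div_le (r := ‖q.2‖) hq
  have hc : 0 ≤ Real.exp (-q.1) * (4 * Real.pi * q.1) ^ (-(n : ℝ) / 2) := by positivity
  have h1 : ‖dampedHeatKernelDeriv k q‖ = |q.2 k| / (2 * q.1) * dampedHeatKernel n q.1 q.2 := by
    rw [dampedHeatKernelDeriv, norm_mul, Real.norm_of_nonneg (dampedHeatKernel_nonneg n hq _),
      norm_neg, norm_div, Real.norm_of_nonneg (by positivity : 0 ≤ 2 * q.1), Real.norm_eq_abs]
  calc ‖dampedHeatKernelDeriv k q‖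
      ≤ ‖q.2‖ / (2 * q.1) * dampedHeatKernel n q.1 q.2 := by
        rw [h1]
        have := dampedHeatKernel_nonneg n hq q.2
        gcongr
    _ = Real.exp (-q.1) * (4 * Real.pi * q.1) ^ (-(n : ℝ) / 2) *
        (‖q.2‖ / (2 * q.1) * Real.exp (-(1 / (4 * q.1)) * ‖q.2‖ ^ 2)) := by
        rw [dampedHeatKernel_eq]; ring
    _ ≤ _ := mul_le_mul_of_nonneg_left key hc
    _ = D q := by simp only [D]; ring

/-- The `k`-th partial derivative of the Bessel potential. -/
noncomputable def besselGDeriv {n : ℕ} (k : Fin n) (x : EuclideanSpace ℝ (Fin n)) : ℂ :=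
  ((∫ t in Ioi (0 : ℝ), dampedHeatKernelDeriv k (t, x) : ℝ) : ℂ)

theorem integrable_besselGDeriv {n : ℕ} (k : Fin n) : Integrable (besselGDeriv k) :=
  (integrable_dampedHeatKernelDeriv k).integral_prod_right.ofReal

theorem integral_dampedHeatKernelDeriv_mul {n : ℕ} (k : Fin n) {t : ℝ} (ht : 0 < t)
    (hi : Integrable fun x => dampedHeatKernelDeriv k (t, x))
    (f : 𝓢(EuclideanSpace ℝ (Fin n), ℂ)) :
    ∫ x, (dampedHeatKernelDeriv k (t, x) : ℂ) * f x =
      -∫ x, (dampedHeatKernel n t x : ℂ) * (∂_{stdVec k} f) x := by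
  have hbdd : ∀ {K : EuclideanSpace ℝ (Fin n) → ℝ} (_ : Integrable K)
      (g : 𝓢(EuclideanSpace ℝ (Fin n), ℂ)), Integrable fun x => (K x : ℂ) * g x := fun hK g =>
    hK.ofReal.mul_bdd (c := SchwartzMap.seminorm ℝ 0 0 g) g.continuous.aestronglyMeasurable
      (.of_forall fun x => g.norm_le_seminorm ℝ _)
  have := integral_bilinear_hasLineDerivAt_right_eq_neg_left_of_integrable (μ := volume)
    (f := fun x => (dampedHeatKernel n t x : ℂ))
    (f' := fun x => (dampedHeatKernelDeriv k (t, x) : ℂ)) (g := f) (g' := ⇑(∂_{stdVec k} f : 𝓢(EuclideanSpace ℝ (Fin n), ℂ)))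
    (v := stdVec k) (B := ContinuousLinearMap.mul ℝ ℂ) (hbdd hi f)
    (hbdd (integrable_dampedHeatKernel n ht) _) (hbdd (integrable_dampedHeatKernel n ht) _)
    (fun x _ => HasDerivAt.ofReal_comp (hasLineDerivAt_dampedHeatKernel k t x))
    (fun x _ => by
      rw [SchwartzMap.lineDerivOp_apply]
      exact (f.differentiableAt.lineDifferentiableAt).hasLineDerivAt)
  simp only [ContinuousLinearMap.mul_apply'] at this
  rw [this, neg_neg]

theorem integral_mul_besselGDeriv {n : ℕ} (k : Fin n) (f : 𝓢(EuclideanSpace ℝ (Fin n), ℂ)) :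
    ∫ x, f x * besselGDeriv k x =
      -∫ x, (∂_{stdVec k} f) x * (((besselG n x).toReal : ℝ) : ℂ) := by
  unfold besselGDeriv
  simp_rw [toReal_besselG]
  rw [integral_mul_integral_kernel (integrable_dampedHeatKernelDeriv k),
    integral_mul_integral_kernel (integrable_dampedHeatKernel_prod n), ← integral_neg]
  refine integral_congr_ae ?_
  filter_upwards [ae_restrict_mem measurableSet_Ioi,
    (integrable_dampedHeatKernelDeriv k).prod_right_ae] with t ht hi
  exact integral_dampedHeatKernelDeriv_mul k ht hi f

/-- Both operators are Fourier multipliers, and multipliers commute. -/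
theorem lineDerivOp_laplacian_comm {n : ℕ} (m : EuclideanSpace ℝ (Fin n))
    (f : 𝓢(EuclideanSpace ℝ (Fin n), ℂ)) : ∂_{m} (Δ f) = Δ (∂_{m} f) := by
  have h1 : (inner ℝ · m : EuclideanSpace ℝ (Fin n) → ℝ).HasTemperateGrowth := by fun_prop
  have h2 : (‖·‖ ^ 2 : EuclideanSpace ℝ (Fin n) → ℝ).HasTemperateGrowth := by fun_prop
  rw [SchwartzMap.laplacian_eq_fourierMultiplierCLM, SchwartzMap.laplacian_eq_fourierMultiplierCLM,
    LineDeriv.lineDerivOp_smul, SchwartzMap.lineDeriv_eq_fourierMultiplierCLM,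
    SchwartzMap.lineDeriv_eq_fourierMultiplierCLM,
    ← SchwartzMap.fourierMultiplierCLM_ofReal ℂ h1, ← SchwartzMap.fourierMultiplierCLM_ofReal ℂ h2,
    ← SchwartzMap.fourierMultiplierCLM_ofReal ℂ h1, ← SchwartzMap.fourierMultiplierCLM_ofReal ℂ h2,
    map_smul,
    SchwartzMap.fourierMultiplierCLM_fourierMultiplierCLM_apply (by fun_prop) (by fun_prop),
    SchwartzMap.fourierMultiplierCLM_fourierMultiplierCLM_apply (by fun_prop) (by fun_prop),
    mul_comm fun x : EuclideanSpace ℝ (Fin n) => (RCLike.ofReal (inner ℝ x m : ℝ) : ℂ)]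

theorem integral_sub_laplacian_mul_besselGDeriv {n : ℕ} (k : Fin n)
    (f : 𝓢(EuclideanSpace ℝ (Fin n), ℂ)) :
    ∫ x, (f - Δ f) x * besselGDeriv k x = -(∂_{stdVec k} f) 0 := by
  rw [integral_mul_besselGDeriv, ← integral_sub_laplacian_mul_besselG (∂_{stdVec k} f),
    sub_eq_add_neg f, LineDeriv.lineDerivOp_add, LineDeriv.lineDerivOp_neg, lineDerivOp_laplacian_comm,
    ← sub_eq_add_neg]

/-! ### Distributions as integrals against Schwartz functions -/

/-- A real test function, regarded as a complex Schwartz function. -/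
noncomputable def toSchwartz {n : ℕ} {O : Opens (EuclideanSpace ℝ (Fin n))} (φ : 𝓓(O, ℝ)) :
    𝓢(EuclideanSpace ℝ (Fin n), ℂ) :=
  HasCompactSupport.toSchwartzMap (f := fun x => (φ x : ℂ))
    (φ.hasCompactSupport.comp_left (g := ((↑) : ℝ → ℂ)) Complex.ofReal_zero)
    (Complex.ofRealCLM.contDiff.comp φ.contDiff)

theorem toSchwartz_apply {n : ℕ} {O : Opens (EuclideanSpace ℝ (Fin n))} (φ : 𝓓(O, ℝ))
    (x : EuclideanSpace ℝ (Fin n)) : toSchwartz φ x = (φ x : ℂ) := rfl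

theorem lineDerivOp_testFunction_apply {n : ℕ} {O : Opens (EuclideanSpace ℝ (Fin n))}
    (m : EuclideanSpace ℝ (Fin n)) (φ : 𝓓(O, ℝ)) (x : EuclideanSpace ℝ (Fin n)) :
    (∂_{m} φ : 𝓓(O, ℝ)) x = lineDeriv ℝ φ x m := by
  rw [TestFunction.lineDerivOp_eq_lineDerivCLM ℝ, TestFunction.lineDerivCLM_apply_of_le]
  simp

theorem toSchwartz_lineDerivOp {n : ℕ} {O : Opens (EuclideanSpace ℝ (Fin n))}
    (m : EuclideanSpace ℝ (Fin n)) (φ : 𝓓(O, ℝ)) :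
    toSchwartz (∂_{m} φ) = ∂_{m} (toSchwartz φ) := by
  ext x
  rw [toSchwartz_apply, lineDerivOp_testFunction_apply, SchwartzMap.lineDerivOp_apply]
  have h : HasLineDerivAt ℝ φ (lineDeriv ℝ φ x m) x m :=
    ((φ.contDiff.differentiable (by simp)) x).lineDifferentiableAt.hasLineDerivAt
  have h' : HasLineDerivAt ℝ (toSchwartz φ) ((lineDeriv ℝ φ x m : ℝ) : ℂ) x m :=
    HasDerivAt.ofReal_comp (f := fun t : ℝ => φ (x + t • m)) h
  exact h'.lineDeriv.symm

theorem regularDist_eq_integral {n : ℕ} {O : Opens (EuclideanSpace ℝ (Fin n))}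
    {f : EuclideanSpace ℝ (Fin n) → ℂ} (hf : LocallyIntegrable f) (φ : 𝓓(O, ℝ)) :
    regularDist O f φ = ∫ x, toSchwartz φ x * f x :=
  regularDist_apply (hf.locallyIntegrableOn _) φ

theorem weakPartial_apply {n : ℕ} {O : Opens (EuclideanSpace ℝ (Fin n))} (k : Fin n)
    (T : 𝓓'(O, ℂ)) (φ : 𝓓(O, ℝ)) : weakPartial k T φ = -T (∂_{stdVec k} φ) := by
  rw [weakPartial, Distribution.lineDerivOp_apply_apply, map_neg]

theorem integrable_toSchwartz_mul {n : ℕ} {O : Opens (EuclideanSpace ℝ (Fin n))}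
    {f : EuclideanSpace ℝ (Fin n) → ℂ} (hf : LocallyIntegrable f) (φ : 𝓓(O, ℝ)) :
    Integrable fun x => toSchwartz φ x * f x := by
  have := hf.integrable_smul_left_of_hasCompactSupport φ.continuous φ.hasCompactSupport
  simpa only [toSchwartz_apply, Complex.real_smul] using this

theorem integrable_schwartz_mul_of_integrable {n : ℕ} {f : EuclideanSpace ℝ (Fin n) → ℂ}
    (hf : Integrable f) (g : 𝓢(EuclideanSpace ℝ (Fin n), ℂ)) :
    Integrable fun x => g x * f x :=
  hf.bdd_mul (c := SchwartzMap.seminorm ℝ 0 0 g) g.continuous.aestronglyMeasurable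
    (.of_forall fun _ => g.norm_le_seminorm ℝ _)

theorem locallyIntegrable_of_memLp_top {n : ℕ} {p : ℝ≥0∞} (hp : 1 ≤ p)
    {f : EuclideanSpace ℝ (Fin n) → ℂ}
    (hf : MemLp f p (volume.restrict ((⊤ : Opens (EuclideanSpace ℝ (Fin n))) : Set _))) :
    LocallyIntegrable f := by
  rw [Opens.coe_top, Measure.restrict_univ] at hf
  exact hf.locallyIntegrable hp

/-- A function of class `W^{2,p}` has a locally integrable weak Laplacian. -/
theorem MemW.exists_weakLaplacian {n : ℕ} {p : ℝ≥0∞} (hp : 1 ≤ p)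
    {v : EuclideanSpace ℝ (Fin n) → ℂ} (hv : MemW ⊤ 2 p v) :
    ∃ g : EuclideanSpace ℝ (Fin n) → ℂ, LocallyIntegrable g ∧
      ∀ φ : 𝓓((⊤ : Opens (EuclideanSpace ℝ (Fin n))), ℝ),
        ∫ x, toSchwartz φ x * g x = ∫ x, Δ (toSchwartz φ) x * v x := by
  have hvl := locallyIntegrable_of_memLp_top hp hv.1
  have h : ∀ k : Fin n, ∃ g : EuclideanSpace ℝ (Fin n) → ℂ, LocallyIntegrable g ∧
      ∀ φ : 𝓓((⊤ : Opens (EuclideanSpace ℝ (Fin n))), ℝ),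
        ∫ x, toSchwartz φ x * g x =
          ∫ x, (∂_{stdVec k} (∂_{stdVec k} (toSchwartz φ))) x * v x := fun k => by
    obtain ⟨g, hg, hgv⟩ := hv.2 2 le_rfl fun _ => k
    have hgl := locallyIntegrable_of_memLp_top hp hg
    refine ⟨g, hgl, fun φ => ?_⟩
    -- For the constant multi-index `(k, k)`, the iterated derivative unfolds to `D_k D_k`.
    have h1 : weakPartial k (weakPartial k (regularDist ⊤ v)) φ = regularDist ⊤ g φ :=
      congrArg (fun T : 𝓓'((⊤ : Opens (EuclideanSpace ℝ (Fin n))), ℂ) => T φ) hgv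
    rw [weakPartial_apply, weakPartial_apply, neg_neg, regularDist_eq_integral hvl,
      regularDist_eq_integral hgl, toSchwartz_lineDerivOp, toSchwartz_lineDerivOp] at h1
    exact h1.symm
  choose g hgl hg using h
  refine ⟨fun x => ∑ k, g k x, locallyIntegrable_finsetSum _ fun k _ => hgl k, fun φ => ?_⟩
  simp_rw [Finset.mul_sum]
  rw [integral_finsetSum _ fun k _ => integrable_toSchwartz_mul (hgl k) φ]
  have hΔ : Δ (toSchwartz φ) =
      ∑ k : Fin n, ∂_{stdVec k} (∂_{stdVec k} (toSchwartz φ)) := by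
    rw [SchwartzMap.laplacian_eq_sum (EuclideanSpace.basisFun (Fin n) ℝ)]
    simp [stdVec]
  simp_rw [hΔ, sum_apply, Finset.sum_mul, hg]
  rw [integral_finsetSum]
  intro k _
  rw [← toSchwartz_lineDerivOp, ← toSchwartz_lineDerivOp]
  exact integrable_toSchwartz_mul hvl _

/-! ### Combinations of `G_n` and `D_k G_n`; uniqueness of coefficients -/

/-- The integrable function `a G_n + ∑ b_k D_k G_n`. -/
noncomputable def besselCombination {n : ℕ} (a : ℂ) (b : Fin n → ℂ)
    (x : EuclideanSpace ℝ (Fin n)) : ℂ :=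
  a * (((besselG n x).toReal : ℝ) : ℂ) + ∑ k, b k * besselGDeriv k x

theorem integrable_besselCombination {n : ℕ} (a : ℂ) (b : Fin n → ℂ) :
    Integrable (besselCombination a b) :=
  ((integrable_besselG n).const_mul a).add
    (integrable_finsetSum _ fun k _ => (integrable_besselGDeriv k).const_mul (b k))

theorem integral_mul_besselCombination {n : ℕ} (a : ℂ) (b : Fin n → ℂ)
    (f : 𝓢(EuclideanSpace ℝ (Fin n), ℂ)) :
    ∫ x, f x * besselCombination a b x =
      a * (∫ x, f x * (((besselG n x).toReal : ℝ) : ℂ)) +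
        ∑ k, b k * ∫ x, f x * besselGDeriv k x := by
  have h1 := integrable_schwartz_mul_of_integrable (integrable_besselG n) f
  have h2 := fun k : Fin n => integrable_schwartz_mul_of_integrable (integrable_besselGDeriv k) f
  simp_rw [← integral_const_mul]
  rw [← integral_finsetSum _ fun k _ => (h2 k).const_mul (b k), ← integral_add (h1.const_mul a)
    (integrable_finsetSum _ fun k _ => (h2 k).const_mul (b k))]
  refine integral_congr_ae (.of_forall fun x => ?_)
  simp only [besselCombination, mul_add, Finset.mul_sum]
  congr 1
  · ring
  · exact Finset.sum_congr rfl fun k _ => by ring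

theorem integral_sub_sub_sub {α : Type*} [MeasurableSpace α] {μ : Measure α} {f g h k : α → ℂ}
    (hf : Integrable f μ) (hg : Integrable g μ) (hh : Integrable h μ) (hk : Integrable k μ) :
    ∫ x, (f x - g x) - (h x - k x) ∂μ =
      (∫ x, f x ∂μ - ∫ x, g x ∂μ) - (∫ x, h x ∂μ - ∫ x, k x ∂μ) := by
  rw [← integral_sub hf hg, ← integral_sub hh hk]
  exact integral_sub (hf.sub hg) (hh.sub hk)

theorem distG_apply {n : ℕ} (φ : 𝓓(punctured n, ℝ)) :
    distG n φ = ∫ x, toSchwartz φ x * (((besselG n x).toReal : ℝ) : ℂ) :=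
  regularDist_eq_integral (integrable_besselG n).locallyIntegrable φ

theorem weakPartial_distG_apply {n : ℕ} (k : Fin n) (φ : 𝓓(punctured n, ℝ)) :
    weakPartial k (distG n) φ = ∫ x, toSchwartz φ x * besselGDeriv k x := by
  rw [weakPartial_apply, distG_apply, toSchwartz_lineDerivOp, integral_mul_besselGDeriv]

theorem IsGRepresentation.apply {n : ℕ} {u v : EuclideanSpace ℝ (Fin n) → ℂ} {c₀ : ℂ}
    {c : Fin n → ℂ} (h : IsGRepresentation u c₀ c v) (hv : LocallyIntegrable v)
    (φ : 𝓓(punctured n, ℝ)) :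
    regularDist (punctured n) u φ =
      (∫ x, toSchwartz φ x * besselCombination c₀ c x) + ∫ x, toSchwartz φ x * v x := by
  have h1 : regularDist (punctured n) u φ = (c₀ • distG n +
      ∑ k : Fin n, c k • weakPartial k (distG n) + regularDist (punctured n) v) φ := by
    rw [← h]
  rw [h1, integral_mul_besselCombination]
  simp only [add_apply, smul_apply, sum_apply, smul_eq_mul, distG_apply,
    weakPartial_distG_apply, regularDist_eq_integral hv]

theorem besselCombination_sub {n : ℕ} (a a' : ℂ) (b b' : Fin n → ℂ)
    (x : EuclideanSpace ℝ (Fin n)) :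
    besselCombination (a - a') (b - b') x = besselCombination a b x - besselCombination a' b' x := by
  simp only [besselCombination, Pi.sub_apply, sub_mul, Finset.sum_sub_distrib]
  ring

theorem ae_ne_zero_point {n : ℕ} (hn : 1 ≤ n) :
    ∀ᵐ x : EuclideanSpace ℝ (Fin n), x ∈ (punctured n : Set (EuclideanSpace ℝ (Fin n))) := by
  have : Nonempty (Fin n) := ⟨⟨0, hn⟩⟩
  exact compl_mem_ae_iff.2 (measure_singleton 0)

/-- A locally integrable function inducing the zero distribution on `ℝⁿ ∖ {0}` vanishes a.e. -/
theorem ae_eq_zero_of_integral_punctured {n : ℕ} (hn : 1 ≤ n)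
    {F : EuclideanSpace ℝ (Fin n) → ℂ} (hF : LocallyIntegrable F)
    (h : ∀ φ : 𝓓(punctured n, ℝ), ∫ x, toSchwartz φ x * F x = 0) : F =ᵐ[volume] 0 := by
  have h1 := (punctured n).isOpen.ae_eq_zero_of_integral_contDiff_smul_eq_zero
    (hF.locallyIntegrableOn _) fun g hg hgs hgt => by
      simpa only [Complex.real_smul] using! h ⟨g, hg, hgs, hgt⟩
  filter_upwards [h1, ae_ne_zero_point hn] with x hx hx0 using hx hx0

/-- A test function on `ℝⁿ ∖ {0}` as a test function on `ℝⁿ`. -/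
noncomputable def extendTest {n : ℕ} (φ : 𝓓(punctured n, ℝ)) :
    𝓓((⊤ : Opens (EuclideanSpace ℝ (Fin n))), ℝ) :=
  ⟨φ, φ.contDiff, φ.hasCompactSupport, subset_univ _⟩

/-- `(1 - Δ)(a G_n + ∑ b_k D_k G_n)` is the linear form `f ↦ a f(0) - ∑ b_k ∂_k f(0)`. -/
theorem integral_sub_laplacian_mul_besselCombination {n : ℕ} (a : ℂ) (b : Fin n → ℂ)
    (f : 𝓢(EuclideanSpace ℝ (Fin n), ℂ)) :
    ∫ x, (f - Δ f) x * besselCombination a b x =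
      a * f 0 - ∑ k, b k * (∂_{stdVec k} f) 0 := by
  rw [integral_mul_besselCombination, integral_sub_laplacian_mul_besselG]
  simp_rw [integral_sub_laplacian_mul_besselGDeriv]
  simp [sub_eq_add_neg]

/-- Value and gradient at the origin can be prescribed independently: test with an affine function
times a cutoff equal to `1` near `0`. The constant `1` isolates `a`, the coordinate functions
isolate the `b_j`. -/
theorem coefficients_eq_zero {n : ℕ} {a : ℂ} {b : Fin n → ℂ}
    (h : ∀ φ : 𝓓((⊤ : Opens (EuclideanSpace ℝ (Fin n))), ℝ),
      a * (toSchwartz φ) 0 - ∑ k, b k * (∂_{stdVec k} (toSchwartz φ)) 0 = 0) :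
    a = 0 ∧ b = 0 := by
  let χ : ContDiffBump (0 : EuclideanSpace ℝ (Fin n)) := ⟨1, 2, one_pos, one_lt_two⟩
  have key : ∀ q : EuclideanSpace ℝ (Fin n) →L[ℝ] ℝ, ∀ r : ℝ,
      a * r - ∑ k, b k * (q (stdVec k) : ℂ) = 0 := fun q r => by
    have hs : HasCompactSupport fun x => χ x * (r + q x) := χ.hasCompactSupport.mul_right
    let φ : 𝓓((⊤ : Opens (EuclideanSpace ℝ (Fin n))), ℝ) :=
      ⟨fun x => χ x * (r + q x), χ.contDiff.mul (contDiff_const.add q.contDiff), hs,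
        subset_univ _⟩
    have h0 : toSchwartz φ 0 = r := by
      rw [toSchwartz_apply]
      have : φ 0 = χ 0 * (r + q 0) := rfl
      rw [this, χ.eventuallyEq_one.eq_of_nhds]
      simp
    have h1 : ∀ k, (∂_{stdVec k} (toSchwartz φ)) 0 = (q (stdVec k) : ℂ) := fun k => by
      rw [← toSchwartz_lineDerivOp, toSchwartz_apply, lineDerivOp_testFunction_apply]
      congr 1
      have h2 : HasFDerivAt φ q 0 := by
        refine (q.hasFDerivAt.const_add r).congr_of_eventuallyEq ?_
        filter_upwards [χ.eventuallyEq_one] with x hx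
        have : φ x = χ x * (r + q x) := rfl
        rw [this, hx]
        simp
      exact (h2.hasLineDerivAt _).lineDeriv
    have := h φ
    simp_rw [h0, h1] at this
    exact this
  refine ⟨by simpa using key 0 1, funext fun j => ?_⟩
  have := key (EuclideanSpace.proj j) 0
  simpa [stdVec, Pi.single_apply, apply_ite Complex.ofReal] using this

end PuncturedSobolev

open scoped SchwartzMap Laplacian in
/-- The uniqueness statement for functions in `W^{2,p}` and `W^{2,p'}` whose difference agrees off
the origin with a combination of the Bessel potential and its derivatives. -/
theorem PuncturedSobolev.coefficients_eq_zero_of_ae_eq {n : ℕ} (hn : 1 ≤ n) {p p' : ℝ≥0∞}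
    (hp : 1 ≤ p) (hp' : 1 ≤ p') {v v' : EuclideanSpace ℝ (Fin n) → ℂ}
    (hv : MemW ⊤ 2 p v) (hv' : MemW ⊤ 2 p' v') {a : ℂ} {b : Fin n → ℂ}
    (hw : (fun x => v' x - v x) =ᵐ[volume] besselCombination a b) : a = 0 ∧ b = 0 := by
  have hvl := locallyIntegrable_of_memLp_top hp hv.1
  have hvl' := locallyIntegrable_of_memLp_top hp' hv'.1
  obtain ⟨g, hgl, hg⟩ := hv.exists_weakLaplacian hp
  obtain ⟨g', hgl', hg'⟩ := hv'.exists_weakLaplacian hp'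
  have hFl : LocallyIntegrable fun x => (v' x - v x) - (g' x - g x) :=
    (hvl'.sub hvl).sub (hgl'.sub hgl)
  -- The integrand's second factor represents `(1 - Δ)(v' - v)` on the whole space, origin included.
  have hF : ∀ φ : 𝓓((⊤ : Opens (EuclideanSpace ℝ (Fin n))), ℝ),
      ∫ x, toSchwartz φ x * ((v' x - v x) - (g' x - g x)) =
        a * (toSchwartz φ) 0 - ∑ k, b k * (∂_{stdVec k} (toSchwartz φ)) 0 := fun φ => by
    rw [← integral_sub_laplacian_mul_besselCombination]
    have hi := integrable_toSchwartz_mul hvl φ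
    have hi' := integrable_toSchwartz_mul hvl' φ
    have hgi := integrable_toSchwartz_mul hgl φ
    have hgi' := integrable_toSchwartz_mul hgl' φ
    have hΔ : ∀ {w : EuclideanSpace ℝ (Fin n) → ℂ}, LocallyIntegrable w →
        Integrable fun x => Δ (toSchwartz φ) x * w x := fun hwl => by
      rw [SchwartzMap.laplacian_eq_sum (EuclideanSpace.basisFun (Fin n) ℝ)]
      simp_rw [sum_apply, Finset.sum_mul]
      refine integrable_finsetSum _ fun k _ => ?_
      rw [← toSchwartz_lineDerivOp, ← toSchwartz_lineDerivOp]
      exact integrable_toSchwartz_mul hwl _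
    have h1 : ∫ x, (toSchwartz φ - Δ (toSchwartz φ)) x * besselCombination a b x =
        ∫ x, (toSchwartz φ x * v' x - toSchwartz φ x * v x) -
          (Δ (toSchwartz φ) x * v' x - Δ (toSchwartz φ) x * v x) := by
      refine integral_congr_ae ?_
      filter_upwards [hw] with x hx
      rw [← hx, sub_apply]
      ring
    have h2 : ∫ x, toSchwartz φ x * ((v' x - v x) - (g' x - g x)) =
        ∫ x, (toSchwartz φ x * v' x - toSchwartz φ x * v x) -
          (toSchwartz φ x * g' x - toSchwartz φ x * g x) :=
      integral_congr_ae (.of_forall fun x => by ring)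
    rw [h1, h2, integral_sub_sub_sub hi' hi hgi' hgi,
      integral_sub_sub_sub hi' hi (hΔ hvl') (hΔ hvl), hg, hg']
  -- A test function on the punctured space vanishes at `0`, and so do its derivatives, which are
  -- again such test functions; the point form is therefore zero on it.
  have hF0 := ae_eq_zero_of_integral_punctured hn hFl fun φ => by
    have h0 : ∀ x ∉ (punctured n : Set (EuclideanSpace ℝ (Fin n))), ∀ ψ : 𝓓(punctured n, ℝ),
        ψ x = 0 := fun x hx ψ => image_eq_zero_of_notMem_tsupport fun h => hx (ψ.tsupport_subset h)
    have h0' : (0 : EuclideanSpace ℝ (Fin n)) ∉ (punctured n : Set (EuclideanSpace ℝ (Fin n))) :=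
      fun h => h rfl
    have h1 := hF (extendTest φ)
    have h2 : toSchwartz (extendTest φ) = toSchwartz φ := rfl
    rw [h2] at h1
    rw [h1]
    simp_rw [← toSchwartz_lineDerivOp, toSchwartz_apply, h0 0 h0']
    simp
  refine coefficients_eq_zero fun φ => ?_
  rw [← hF]
  refine integral_eq_zero_of_ae ?_
  filter_upwards [hF0] with x hx
  rw [hx]
  simp

theorem theorem3p11 (n : ℕ) (hn : 1 ≤ n)
    (p p' : ℝ≥0∞) (hp : 1 < p) (hp_top : p < ∞) (hp' : 1 < p') (hp'_top : p' < ∞)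
    (u : EuclideanSpace ℝ (Fin n) → ℂ)
    (hu : PuncturedSobolev.MemWLaplacian (PuncturedSobolev.punctured n) p u)
    (hu' : PuncturedSobolev.MemWLaplacian (PuncturedSobolev.punctured n) p' u)
    (c₀ c₀' : ℂ) (c c' : Fin n → ℂ) (v v' : EuclideanSpace ℝ (Fin n) → ℂ)
    (hv : PuncturedSobolev.MemW ⊤ 2 p v) (hv' : PuncturedSobolev.MemW ⊤ 2 p' v')
    (hrep : PuncturedSobolev.IsGRepresentation u c₀ c v)
    (hrep' : PuncturedSobolev.IsGRepresentation u c₀' c' v') :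
    c₀ = c₀' ∧ (∀ k : Fin n, c k = c' k) ∧ v =ᵐ[volume] v' := by
  open PuncturedSobolev in
  have hvl := locallyIntegrable_of_memLp_top hp.le hv.1
  have hvl' := locallyIntegrable_of_memLp_top hp'.le hv'.1
  have hH := (integrable_besselCombination c₀ c).locallyIntegrable
  have hH' := (integrable_besselCombination c₀' c').locallyIntegrable
  have h0 : (fun x => (v' x - v x) - (besselCombination c₀ c x - besselCombination c₀' c' x))
      =ᵐ[volume] 0 := by
    -- Both representations have the same pairing `regularDist (punctured n) u φ`, so `u` drops out.
    refine ae_eq_zero_of_integral_punctured hn ((hvl'.sub hvl).sub (hH.sub hH')) fun φ => ?_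
    have h1 := (hrep.apply hvl φ).symm.trans (hrep'.apply hvl' φ)
    have h2 : ∫ x, toSchwartz φ x *
        ((v' x - v x) - (besselCombination c₀ c x - besselCombination c₀' c' x)) =
        ∫ x, (toSchwartz φ x * v' x - toSchwartz φ x * v x) -
          (toSchwartz φ x * besselCombination c₀ c x -
            toSchwartz φ x * besselCombination c₀' c' x) :=
      integral_congr_ae (.of_forall fun x => by ring)
    have hi := integrable_toSchwartz_mul hvl φ
    have hi' := integrable_toSchwartz_mul hvl' φ
    have hHi := integrable_toSchwartz_mul hH φ
    have hHi' := integrable_toSchwartz_mul hH' φ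
    rw [h2, integral_sub_sub_sub hi' hi hHi hHi']
    linear_combination -h1
  have hw : (fun x => v' x - v x) =ᵐ[volume] besselCombination (c₀ - c₀') (c - c') := by
    filter_upwards [h0] with x hx
    rw [besselCombination_sub]
    exact sub_eq_zero.1 hx
  obtain ⟨ha, hb⟩ := coefficients_eq_zero_of_ae_eq hn hp.le hp'.le hv hv' hw
  refine ⟨sub_eq_zero.1 ha, fun k => sub_eq_zero.1 (congrFun hb k), ?_⟩
  filter_upwards [hw] with x hx
  rw [ha, hb] at hx
  have : v' x - v x = 0 := by simpa [besselCombination] using hx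
  exact (sub_eq_zero.1 this).symm
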